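/- Let $(M,c)$ be a smooth conformal manifold of positive definite signature and dimension $n\ge 3$, and let $\gamma:J\to M$ be a smooth regular curve with an arbitrary parametrization $t\in J$, $J\subset\mathbb{R}$ open. Fix a metric $g\in c$, with Levi-Civita connection $\nabla$ and Schouten tensor $\mathsf P=\frac1{n-2}\bigl(\mathrm{Ric}-\frac{R}{2(n-1)}g\bigr)$. In the scale $g$ a standard tractor is a triple $(\sigma,\mu^a,\rho)$, the tractor metric is $$\langle(\sigma,\mu,\rho),(\tau,\nu,\pi)\rangle=g(\mu,\nu)+\sigma\pi+\rho\tau,$$ and the tractor connection is $$\nabla_a(\sigma,\mu^b,\rho)=(\nabla_a\sigma-\mu_a,\ \nabla_a\mu^b+\delta_a{}^b\rho+\mathsf P_a{}^b\sigma,\ \nabla_a\rho-\mathsf P_{ac}\mu^c).$$ Denote by a prime the derivative with respect to $t$: for tractor fields along the curve it is the tractor covariant derivative in the direction of $\dot\gamma$. Put $$\mathbf T=(0,0,g(\dot\gamma,\dot\gamma)^{-1/2}),\qquad \mathbf U=\mathbf T',\qquad \Phi=\langle\mathbf U'',\mathbf U''\rangle-\langle\mathbf U',\mathbf U'\rangle^2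 .$$ Near a parameter value $t_0$ with $\Phi(t_0)\neq 0$, a conformal arc-length parameter is a function $s$ with $ds=\Phi^{1/4}\,dt$. The first conformal curvature $K_1$ of the curve is $-\frac12\langle\mathbf U',\mathbf U'\rangle$, computed with respect to the parametrization of the curve by $s$. **Proposition.** At every $t_0\in J$ with $\Phi(t_0)\ne0$, the first conformal curvature $K_1$ is well defined (a conformal arc-length parametrization exists near $t_0$, and the value at $t_0$ does not depend on its choice), and with respect to the arbitrary parameter $t$ it is given by $$K_1=-\tfrac12\,\Phi^{-1/2}\Bigl(\langle\mathbf U',\mathbf U'\rangle-\tfrac12(\ln\Phi)''+\tfrac1{16}\bigl((\ln\Phi)'\bigr)^2\Bigr) =-\tfrac12\,\Phi^{-5/2}\Bigl(\Phi^2\langle\mathbf U',\mathbf U'\rangle-\tfrac12\Phi\Phi''+\tfrac9{16}(\Phi')^2\Bigr).$$ -/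

import Mathlib

open scoped Manifold ContDiff Topology

noncomputable section

namespace ConformalCurve

variable {n : ℕ}
  {M : Type*} [TopologicalSpace M] [ChartedSpace (EuclideanSpace ℝ (Fin n)) M]
  [IsManifold (𝓡 n) ∞ M]

/-- Smooth Riemannian metrics on the `n`-manifold `M`. -/
abbrev Metric (n : ℕ) (M : Type*) [TopologicalSpace M]
    [ChartedSpace (EuclideanSpace ℝ (Fin n)) M] [IsManifold (𝓡 n) ∞ M] :=
  Bundle.ContMDiffRiemannianMetric (𝓡 n) ∞ (EuclideanSpace ℝ (Fin n))
    (fun x : M => TangentSpace (𝓡 n) x)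

/-- Two metrics are conformal if they differ by an everywhere positive function. (The function is
then automatically smooth.) -/
def IsConformal (g h : Metric n M) : Prop :=
  ∃ f : M → ℝ, (∀ x, 0 < f x) ∧
    ∀ (x : M) (v w : TangentSpace (𝓡 n) x), h.inner x v w = f x * g.inner x v w

/-- A conformal structure of positive definite signature: a full class of Riemannian metrics that
differ by positive functions. Its elements are the metrics of the conformal class, that is, the
choices of a conformal scale. -/
structure ConformalStructure (n : ℕ) (M : Type*) [TopologicalSpace M]
    [ChartedSpace (EuclideanSpace ℝ (Fin n)) M] [IsManifold (𝓡 n) ∞ M] where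
  metrics : Set (Metric n M)
  nonempty : metrics.Nonempty
  mem_iff : ∀ g ∈ metrics, ∀ h : Metric n M, h ∈ metrics ↔ IsConformal g h

/-! ### The metric and its curvature in a chart

`e` is a chart of `M`, and `y` is a point of its target. -/

section Chart

variable (g : Metric n M) (e : OpenPartialHomeomorph M (EuclideanSpace ℝ (Fin n)))
  (y : EuclideanSpace ℝ (Fin n))

/-- The coordinate vector field `∂/∂yⁱ` of the chart `e`, at the point with coordinates `y`. -/
def coordVector (i : Fin n) : TangentSpace (𝓡 n) (e.symm y) :=
  mfderiv (𝓡 n) (𝓡 n) e.symm y (EuclideanSpace.single i (1 : ℝ))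

/-- The coefficients `g_ij` of the metric in the chart. -/
def metricMatrix : Matrix (Fin n) (Fin n) ℝ :=
  Matrix.of fun i j => g.inner (e.symm y) (coordVector e y i) (coordVector e y j)

/-- The coefficients `g^ij` of the inverse metric. -/
def inverseMetric : Matrix (Fin n) (Fin n) ℝ := (metricMatrix g e y)⁻¹

/-- The partial derivative `∂_i f` of a function of the coordinates. -/
def partialDeriv (i : Fin n) (f : EuclideanSpace ℝ (Fin n) → ℝ) : ℝ :=
  fderiv ℝ f y (EuclideanSpace.single i (1 : ℝ))

/-- The Christoffel symbols `Γ^k_ij` of the Levi-Civita connection. -/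
def christoffel (k i j : Fin n) : ℝ :=
  (1 / 2) * ∑ l, inverseMetric g e y k l *
    (partialDeriv y i (fun z => metricMatrix g e z j l)
      + partialDeriv y j (fun z => metricMatrix g e z i l)
      - partialDeriv y l (fun z => metricMatrix g e z i j))

/-- The Ricci tensor `Ric_ij = ∂_k Γ^k_ij - ∂_j Γ^k_ik + Γ^k_kl Γ^l_ij - Γ^k_jl Γ^l_ik`
(positive on round spheres). -/
def ricci (i j : Fin n) : ℝ :=
  ∑ k, (partialDeriv y k (fun z => christoffel g e z k i j)
    - partialDeriv y j (fun z => christoffel g e z k i k)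
    + ∑ l, (christoffel g e y k k l * christoffel g e y l i j
      - christoffel g e y k j l * christoffel g e y l i k))

/-- The scalar curvature. -/
def scalarCurvature : ℝ := ∑ i, ∑ j, inverseMetric g e y i j * ricci g e y i j

/-- The Schouten tensor `P_ij = (Ric_ij - R g_ij / (2 (n - 1))) / (n - 2)`. -/
def schouten (i j : Fin n) : ℝ :=
  (ricci g e y i j - scalarCurvature g e y / (2 * ((n : ℝ) - 1)) * metricMatrix g e y i j)
    / ((n : ℝ) - 2)

/-- The Schouten tensor with its second index raised, `P_i^k`. -/
def schoutenRaised (i k : Fin n) : ℝ := ∑ l, schouten g e y i l * inverseMetric g e y l k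

end Chart

/-! ### Tractors -/

/-- A standard tractor `(σ, μ^a, ρ)` in the splitting of the tractor bundle given by a scale, the
middle slot being given by its components in a chart. (The scale also trivializes the density
bundles.) -/
@[ext]
structure Tractor (n : ℕ) where
  top : ℝ
  mid : Fin n → ℝ
  bot : ℝ

/-- The standard tractor metric `⟨(σ, μ, ρ), (τ, ν, π)⟩ = g(μ, ν) + σ π + ρ τ` at the point with
coordinates `y`. -/
def tractorMetric (g : Metric n M) (e : OpenPartialHomeomorph M (EuclideanSpace ℝ (Fin n)))
    (y : EuclideanSpace ℝ (Fin n)) (A B : Tractor n) : ℝ :=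
  ∑ i, ∑ j, metricMatrix g e y i j * A.mid i * B.mid j + A.top * B.bot + A.bot * B.top

section Curve

variable (g : Metric n M) (e : OpenPartialHomeomorph M (EuclideanSpace ℝ (Fin n))) (γ : ℝ → M)

/-- The components `U^i` of the tangent vector of the parametrized curve `γ` in the chart. -/
def velocity (t : ℝ) (i : Fin n) : ℝ := deriv (fun r => e (γ r) i) t

/-- The length `u = √(U_c U^c)` of the tangent vector. -/
def speed (t : ℝ) : ℝ :=
  √(∑ i, ∑ j, metricMatrix g e (e (γ t)) i j * velocity e γ t i * velocity e γ t j)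

/-- The derivative `U^c ∇_c` of a tractor field along the curve with respect to the standard
tractor connection
`∇_a (σ, μ^b, ρ) = (∇_a σ - μ_a, ∇_a μ^b + δ_a^b ρ + P_a^b σ, ∇_a ρ - P_ac μ^c)`. -/
def tractorDeriv (A : ℝ → Tractor n) (t : ℝ) : Tractor n where
  top := deriv (fun r => (A r).top) t
    - ∑ i, ∑ j, metricMatrix g e (e (γ t)) i j * velocity e γ t i * (A t).mid j
  mid k := deriv (fun r => (A r).mid k) t
    + ∑ i, ∑ j, christoffel g e (e (γ t)) k i j * velocity e γ t i * (A t).mid j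
    + velocity e γ t k * (A t).bot
    + (∑ i, velocity e γ t i * schoutenRaised g e (e (γ t)) i k) * (A t).top
  bot := deriv (fun r => (A r).bot) t
    - ∑ i, ∑ j, schouten g e (e (γ t)) i j * velocity e γ t i * (A t).mid j

/-- The canonical tractor lift `𝐓 = (0, 0, u⁻¹)` of the curve. -/
def tractorT (t : ℝ) : Tractor n := ⟨0, 0, (speed g e γ t)⁻¹⟩

/-- `𝐔 = d𝐓/dt`. -/
def tractorU : ℝ → Tractor n := tractorDeriv g e γ (tractorT g e γ)

/-- `𝐔' = d²𝐓/dt²`. -/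
def tractorU' : ℝ → Tractor n := tractorDeriv g e γ (tractorU g e γ)

/-- `𝐔'' = d³𝐓/dt³`. -/
def tractorU'' : ℝ → Tractor n := tractorDeriv g e γ (tractorU' g e γ)

/-- The function `α = ⟨𝐔', 𝐔'⟩`. -/
def alpha (t : ℝ) : ℝ :=
  tractorMetric g e (e (γ t)) (tractorU' g e γ t) (tractorU' g e γ t)

/-- The relative conformal invariant `Φ = ⟨𝐔'', 𝐔''⟩ - ⟨𝐔', 𝐔'⟩²`. -/
def Phi (t : ℝ) : ℝ :=
  tractorMetric g e (e (γ t)) (tractorU'' g e γ t) (tractorU'' g e γ t) - alpha g e γ t ^ 2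

/-- Near `t₀`, the function `s` is a conformal arc-length parameter of the curve `γ`, i.e.
`ds = Φ^(1/4) dt`, and `δ` is the curve `γ` reparametrized by `s`. -/
structure IsConformalArcLengthReparam (t₀ : ℝ) (s : ℝ → ℝ) (δ : ℝ → M) : Prop where
  hasDerivAt : ∀ᶠ t in 𝓝 t₀, HasDerivAt s (Phi g e γ t ^ (1 / 4 : ℝ)) t
  reparam : ∀ᶠ t in 𝓝 t₀, δ (s t) = γ t

/-- `K` is a value of the first conformal curvature `K₁` of the curve `γ` at the point `γ t₀`:
`K₁ = -⟨𝐔', 𝐔'⟩ / 2` with `𝐔'` taken with respect to a conformal arc-length parametrization. -/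
def IsFirstConformalCurvatureAt (t₀ : ℝ) (K : ℝ) : Prop :=
  ∃ (s : ℝ → ℝ) (δ : ℝ → M), IsConformalArcLengthReparam g e γ t₀ s δ ∧
    K = -(1 / 2) * alpha g e δ (s t₀)

end Curve

end ConformalCurve

end

/-! The proof fixes the metric and the chart and compares the curve with its reparametrization by
`s`, where `ds = p dt` and `p = Φ^(1/4)`. Speed scales by `p⁻¹`, so the reparametrized curve has
canonical lift `p𝐓`. Applying `p⁻¹ d/dt` twice gives first `f𝐓 + 𝐔` and then `p⁻¹ (f'𝐓 + f𝐔 + 𝐔')`,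
with `f = p'/p = (ln Φ)'/4`.

The tractor connection preserves the tractor metric (`hasDerivAt_tractorMetric`). Differentiating
`⟨𝐓,𝐔⟩ = 0` and `⟨𝐔,𝐔⟩ = 1` therefore gives `⟨𝐓,𝐔'⟩ = -1` and `⟨𝐔,𝐔'⟩ = 0`. Hence the new `α` is
`p⁻² (α - 2f' + f²)` (`alpha_reparam`), which is the first formula once `f` is inserted; the second
is calculus with logarithms (`log_deriv_expression`).

The fourth root needs `Φ > 0`. The part of `𝐔''` orthogonal to `𝐔` is also orthogonal to `𝐓`, where
the tractor metric is positive semidefinite, and its square is `Φ` (`Phi_nonneg`). Thus `Φ ≠ 0`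
forces positivity nearby; integrating `p` and inverting the primitive yields an arc-length
parameter. The value depends only on the germ of the curve and on `p`, hence not on the choice of
`s`. -/

namespace ConformalCurve

/-! ### Smoothness and metric compatibility of the geometric data in a chart. -/

section ChartGeometry

variable {n : ℕ}
  {M : Type*} [TopologicalSpace M] [ChartedSpace (EuclideanSpace ℝ (Fin n)) M]
  {e : OpenPartialHomeomorph M (EuclideanSpace ℝ (Fin n))}

theorem chart_mdifferentiable (he : e ∈ IsManifold.maximalAtlas (𝓡 n) ∞ M) :
    e.MDifferentiable (𝓡 n) (𝓡 n) :=
  ⟨(contMDiffOn_of_mem_maximalAtlas he).mdifferentiableOn (by simp),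
    (contMDiffOn_symm_of_mem_maximalAtlas he).mdifferentiableOn (by simp)⟩

variable [IsManifold (𝓡 n) ∞ M] (g : Metric n M)

/-- The coordinate field is the image of the constant section under the tangent map of `e.symm`. On
the open target, derivatives within the set are ordinary derivatives. -/
theorem contMDiffOn_coordVector (he : e ∈ IsManifold.maximalAtlas (𝓡 n) ∞ M) (i : Fin n) :
    ContMDiffOn (𝓡 n) ((𝓡 n).prod 𝓘(ℝ, EuclideanSpace ℝ (Fin n))) ∞
      (fun y => Bundle.TotalSpace.mk' (EuclideanSpace ℝ (Fin n))
        (E := fun x : M => TangentSpace (𝓡 n) x) (e.symm y) (coordVector e y i)) e.target := by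
  have h1 := (contMDiffOn_symm_of_mem_maximalAtlas he).contMDiffOn_tangentMapWithin
    (m := ∞) (by simp) e.open_target.uniqueMDiffOn
  have h2 : ContMDiffOn (𝓡 n) ((𝓡 n).prod 𝓘(ℝ, EuclideanSpace ℝ (Fin n))) ∞
      (fun y : EuclideanSpace ℝ (Fin n) =>
        (⟨y, EuclideanSpace.single i (1 : ℝ)⟩ : TangentBundle (𝓡 n) (EuclideanSpace ℝ (Fin n))))
      e.target := by
    intro y _
    rw [Bundle.contMDiffWithinAt_totalSpace]
    refine ⟨contMDiffWithinAt_id, ?_⟩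
    simp only [trivializationAt_model_space_apply]
    exact contMDiffWithinAt_const
  refine (h1.comp h2 (fun y hy => hy)).congr fun y hy => ?_
  simp only [Function.comp, tangentMapWithin, coordVector,
    mfderivWithin_of_isOpen e.open_target hy]

theorem contDiffOn_metricMatrix (he : e ∈ IsManifold.maximalAtlas (𝓡 n) ∞ M) (i j : Fin n) :
    ContDiffOn ℝ ∞ (fun y => metricMatrix g e y i j) e.target := by
  have hg : ContMDiffOn (𝓡 n) ((𝓡 n).prod 𝓘(ℝ, EuclideanSpace ℝ (Fin n) →L[ℝ]
      EuclideanSpace ℝ (Fin n) →L[ℝ] ℝ)) ∞ (fun y => Bundle.TotalSpace.mk'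
        (EuclideanSpace ℝ (Fin n) →L[ℝ] EuclideanSpace ℝ (Fin n) →L[ℝ] ℝ)
        (E := fun x : M => TangentSpace (𝓡 n) x →L[ℝ] TangentSpace (𝓡 n) x →L[ℝ] ℝ)
        (e.symm y) (g.inner (e.symm y))) e.target :=
    g.contMDiff.comp_contMDiffOn (contMDiffOn_symm_of_mem_maximalAtlas he)
  have h := ContMDiffOn.clm_bundle_apply₂ (F₃ := ℝ) (E₃ := Bundle.Trivial M ℝ) hg
    (contMDiffOn_coordVector he i) (contMDiffOn_coordVector he j)
  rw [← contMDiffOn_iff_contDiffOn]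
  intro y hy
  have h' := h y hy
  rw [Bundle.contMDiffWithinAt_totalSpace] at h'
  exact h'.2

theorem metricMatrix_isSymm (y : EuclideanSpace ℝ (Fin n)) : (metricMatrix g e y).IsSymm := by
  ext i j
  exact g.symm _ _ _

/-- The quadratic form at `a` is `g(Dw, Dw)`, where `w` has components `a` and `D`, the differential
of the inverse chart, is injective. -/
theorem metricMatrix_posDef (he : e ∈ IsManifold.maximalAtlas (𝓡 n) ∞ M)
    {y : EuclideanSpace ℝ (Fin n)} (hy : y ∈ e.target) : (metricMatrix g e y).PosDef := by
  refine Matrix.PosDef.of_dotProduct_mulVec_pos ?_ fun a ha => ?_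
  · exact metricMatrix_isSymm g y
  · set w : EuclideanSpace ℝ (Fin n) := WithLp.toLp 2 a
    set D := mfderiv (𝓡 n) (𝓡 n) e.symm y
    have hinj : Function.Injective D :=
      (chart_mdifferentiable he).symm.mfderiv_injective (x := y) hy
    have hw : D w ≠ 0 := by
      intro h
      have : w = 0 := hinj (h.trans (map_zero D).symm)
      exact ha (by simpa [w] using this)
    have hsum : D w = ∑ i, a i • coordVector e y i := by
      have : w = ∑ i, a i • EuclideanSpace.single i (1 : ℝ) := by
        ext k
        simp [w, Finset.sum_apply, Pi.single_apply]
      rw [this]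
      exact (map_sum D _ _).trans (Finset.sum_congr rfl fun i _ => map_smul D _ _)
    have h := g.pos _ _ hw
    rw [hsum] at h
    refine h.trans_eq ?_
    rw [map_sum]
    simp only [map_smul, sum_apply, smul_apply, map_sum,
      dotProduct, Matrix.mulVec, metricMatrix, Matrix.of_apply, Finset.mul_sum, smul_eq_mul,
      star_trivial]
    rw [Finset.sum_comm]
    refine Finset.sum_congr rfl fun i _ => Finset.sum_congr rfl fun j _ => ?_
    ring

theorem _root_.contDiffOn_matrix_det {E : Type*} [NormedAddCommGroup E] [NormedSpace ℝ E]
    {m : ℕ} {A : E → Matrix (Fin m) (Fin m) ℝ} {s : Set E}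
    (hA : ∀ i j, ContDiffOn ℝ ∞ (fun y => A y i j) s) :
    ContDiffOn ℝ ∞ (fun y => (A y).det) s := by
  simp only [Matrix.det_apply]
  exact ContDiffOn.sum fun σ _ => (contDiffOn_prod fun i _ => hA _ _).const_smul _

theorem _root_.contDiffOn_matrix_inv {E : Type*} [NormedAddCommGroup E] [NormedSpace ℝ E]
    {m : ℕ} {A : E → Matrix (Fin m) (Fin m) ℝ} {s : Set E}
    (hA : ∀ i j, ContDiffOn ℝ ∞ (fun y => A y i j) s) (h0 : ∀ y ∈ s, (A y).det ≠ 0)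
    (i j : Fin m) : ContDiffOn ℝ ∞ (fun y => (A y)⁻¹ i j) s := by
  -- Cramer's rule: an entry of the adjugate is the determinant of `A` with one row replaced by a
  -- constant row.
  simp only [Matrix.inv_def, Ring.inverse_eq_inv', Matrix.smul_apply, smul_eq_mul,
    Matrix.adjugate_apply]
  refine ((contDiffOn_matrix_det hA).inv h0).mul (contDiffOn_matrix_det fun k l => ?_)
  simp only [Matrix.updateRow_apply]
  split_ifs
  · exact contDiffOn_const
  · exact hA k l

theorem contDiffOn_partialDeriv {U : Set (EuclideanSpace ℝ (Fin n))} (hU : IsOpen U)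
    {f : EuclideanSpace ℝ (Fin n) → ℝ} (hf : ContDiffOn ℝ ∞ f U) (i : Fin n) :
    ContDiffOn ℝ ∞ (fun y => partialDeriv y i f) U :=
  (hf.fderiv_of_isOpen hU (by simp)).clm_apply contDiffOn_const

theorem metricMatrix_det_ne_zero (he : e ∈ IsManifold.maximalAtlas (𝓡 n) ∞ M)
    {y : EuclideanSpace ℝ (Fin n)} (hy : y ∈ e.target) : (metricMatrix g e y).det ≠ 0 :=
  (metricMatrix_posDef g he hy).det_pos.ne'

theorem contDiffOn_inverseMetric (he : e ∈ IsManifold.maximalAtlas (𝓡 n) ∞ M) (i j : Fin n) :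
    ContDiffOn ℝ ∞ (fun y => inverseMetric g e y i j) e.target :=
  contDiffOn_matrix_inv (contDiffOn_metricMatrix g he)
    (fun _ hy => metricMatrix_det_ne_zero g he hy) i j

theorem contDiffOn_christoffel (he : e ∈ IsManifold.maximalAtlas (𝓡 n) ∞ M) (k i j : Fin n) :
    ContDiffOn ℝ ∞ (fun y => christoffel g e y k i j) e.target := by
  have h := fun a b c =>
    contDiffOn_partialDeriv e.open_target (contDiffOn_metricMatrix g he a b) c
  exact contDiffOn_const.mul (ContDiffOn.sum fun l _ =>
    (contDiffOn_inverseMetric g he k l).mul (((h j l i).add (h i l j)).sub (h i j l)))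

theorem contDiffOn_ricci (he : e ∈ IsManifold.maximalAtlas (𝓡 n) ∞ M) (i j : Fin n) :
    ContDiffOn ℝ ∞ (fun y => ricci g e y i j) e.target := by
  have hΓ := contDiffOn_christoffel g he
  have h := fun a b c d => contDiffOn_partialDeriv e.open_target (hΓ a b c) d
  exact ContDiffOn.sum fun k _ => ((h k i j k).sub (h k i k j)).add
    (ContDiffOn.sum fun l _ => ((hΓ k k l).mul (hΓ l i j)).sub ((hΓ k j l).mul (hΓ l i k)))

theorem contDiffOn_schouten (he : e ∈ IsManifold.maximalAtlas (𝓡 n) ∞ M) (i j : Fin n) :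
    ContDiffOn ℝ ∞ (fun y => schouten g e y i j) e.target := by
  have hR : ContDiffOn ℝ ∞ (fun y => scalarCurvature g e y) e.target :=
    ContDiffOn.sum fun i _ => ContDiffOn.sum fun j _ =>
      (contDiffOn_inverseMetric g he i j).mul (contDiffOn_ricci g he i j)
  exact ((contDiffOn_ricci g he i j).sub
    ((hR.div_const _).mul (contDiffOn_metricMatrix g he i j))).div_const _

theorem contDiffOn_schoutenRaised (he : e ∈ IsManifold.maximalAtlas (𝓡 n) ∞ M) (i j : Fin n) :
    ContDiffOn ℝ ∞ (fun y => schoutenRaised g e y i j) e.target :=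
  ContDiffOn.sum fun l _ =>
    (contDiffOn_schouten g he i l).mul (contDiffOn_inverseMetric g he l j)

theorem sum_metricMatrix_mul_inverseMetric (he : e ∈ IsManifold.maximalAtlas (𝓡 n) ∞ M)
    {y : EuclideanSpace ℝ (Fin n)} (hy : y ∈ e.target) (i j : Fin n) :
    ∑ k, metricMatrix g e y i k * inverseMetric g e y k j = if i = j then 1 else 0 := by
  have h := Matrix.mul_nonsing_inv (metricMatrix g e y)
    (metricMatrix_det_ne_zero g he hy).isUnit
  have h' := congrFun (congrFun h i) j
  rwa [Matrix.mul_apply, Matrix.one_apply] at h'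

theorem sum_schoutenRaised_mul_metricMatrix (he : e ∈ IsManifold.maximalAtlas (𝓡 n) ∞ M)
    {y : EuclideanSpace ℝ (Fin n)} (hy : y ∈ e.target) (i j : Fin n) :
    ∑ k, schoutenRaised g e y i k * metricMatrix g e y k j = schouten g e y i j := by
  have h := Matrix.nonsing_inv_mul (metricMatrix g e y)
    (metricMatrix_det_ne_zero g he hy).isUnit
  have h' : schoutenRaised g e y = Matrix.of (schouten g e y) * (metricMatrix g e y)⁻¹ := by
    ext a b
    simp [Matrix.mul_apply, schoutenRaised, inverseMetric]
  change ((Matrix.of (schoutenRaised g e y)) * metricMatrix g e y) i j = _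
  rw [h']
  change (Matrix.of (schouten g e y) * (metricMatrix g e y)⁻¹ * metricMatrix g e y) i j = _
  rw [Matrix.mul_assoc, h, Matrix.mul_one, Matrix.of_apply]

/-- The Christoffel symbols of the first kind in terms of the metric coefficients. -/
theorem sum_metricMatrix_mul_christoffel (he : e ∈ IsManifold.maximalAtlas (𝓡 n) ∞ M)
    {y : EuclideanSpace ℝ (Fin n)} (hy : y ∈ e.target) (m i j : Fin n) :
    ∑ k, metricMatrix g e y m k * christoffel g e y k i j =
      (1 / 2) * (partialDeriv y i (fun z => metricMatrix g e z j m)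
        + partialDeriv y j (fun z => metricMatrix g e z i m)
        - partialDeriv y m (fun z => metricMatrix g e z i j)) := by
  simp only [christoffel]
  set F : Fin n → ℝ := fun l => partialDeriv y i (fun z => metricMatrix g e z j l)
    + partialDeriv y j (fun z => metricMatrix g e z i l)
    - partialDeriv y l (fun z => metricMatrix g e z i j) with hF
  change ∑ k, metricMatrix g e y m k * (1 / 2 * ∑ l, inverseMetric g e y k l * F l) = 1 / 2 * F m
  calc ∑ k, metricMatrix g e y m k * (1 / 2 * ∑ l, inverseMetric g e y k l * F l)
      = 1 / 2 * ∑ l, (∑ k, metricMatrix g e y m k * inverseMetric g e y k l) * F l := by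
        simp only [Finset.mul_sum, Finset.sum_mul]
        rw [Finset.sum_comm]
        refine Finset.sum_congr rfl fun k _ => Finset.sum_congr rfl fun l _ => ?_
        ring
    _ = 1 / 2 * F m := by
        simp [sum_metricMatrix_mul_inverseMetric g he hy]

/-- The Levi-Civita connection is metric: `∂_k g_ij = g_jl Γ^l_ki + g_il Γ^l_kj`. -/
theorem partialDeriv_metricMatrix (he : e ∈ IsManifold.maximalAtlas (𝓡 n) ∞ M)
    {y : EuclideanSpace ℝ (Fin n)} (hy : y ∈ e.target) (k i j : Fin n) :
    partialDeriv y k (fun z => metricMatrix g e z i j) =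
      ∑ l, metricMatrix g e y j l * christoffel g e y l k i
        + ∑ l, metricMatrix g e y i l * christoffel g e y l k j := by
  have hs : ∀ a b : Fin n, (fun z => metricMatrix g e z a b) = fun z => metricMatrix g e z b a :=
    fun a b => funext fun z => (metricMatrix_isSymm g z).apply b a
  -- In the sum of the two Christoffel symbols of the first kind, the derivatives in directions `i`
  -- and `j` cancel by the symmetry of the metric.
  rw [sum_metricMatrix_mul_christoffel g he hy, sum_metricMatrix_mul_christoffel g he hy,
    hs j i, hs k j, hs k i]
  ring

end ChartGeometry
end ConformalCurve

/-! ### Tractor algebra and the tractor connection along a curve. -/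

namespace ConformalCurve

namespace Tractor

variable {n : ℕ}

instance : Add (Tractor n) := ⟨fun A B => ⟨A.top + B.top, A.mid + B.mid, A.bot + B.bot⟩⟩

instance : SMul ℝ (Tractor n) := ⟨fun c A => ⟨c * A.top, c • A.mid, c * A.bot⟩⟩

@[simp] theorem add_top (A B : Tractor n) : (A + B).top = A.top + B.top := rfl
@[simp] theorem add_mid (A B : Tractor n) : (A + B).mid = A.mid + B.mid := rfl
@[simp] theorem add_bot (A B : Tractor n) : (A + B).bot = A.bot + B.bot := rfl
@[simp] theorem smul_top (c : ℝ) (A : Tractor n) : (c • A).top = c * A.top := rfl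
@[simp] theorem smul_mid (c : ℝ) (A : Tractor n) : (c • A).mid = c • A.mid := rfl
@[simp] theorem smul_bot (c : ℝ) (A : Tractor n) : (c • A).bot = c * A.bot := rfl

/-- A smooth tractor field on a set of parameters. -/
structure SmoothOn (A : ℝ → Tractor n) (I : Set ℝ) : Prop where
  top : ContDiffOn ℝ ∞ (fun t => (A t).top) I
  mid : ∀ k, ContDiffOn ℝ ∞ (fun t => (A t).mid k) I
  bot : ContDiffOn ℝ ∞ (fun t => (A t).bot) I

theorem SmoothOn.add {A B : ℝ → Tractor n} {I : Set ℝ} (hA : SmoothOn A I) (hB : SmoothOn B I) :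
    SmoothOn (fun t => A t + B t) I :=
  ⟨hA.top.add hB.top, fun k => (hA.mid k).add (hB.mid k), hA.bot.add hB.bot⟩

theorem SmoothOn.smul {f : ℝ → ℝ} {A : ℝ → Tractor n} {I : Set ℝ} (hf : ContDiffOn ℝ ∞ f I)
    (hA : SmoothOn A I) : SmoothOn (fun t => f t • A t) I :=
  ⟨hf.mul hA.top, fun k => hf.mul (hA.mid k), hf.mul hA.bot⟩

end Tractor

theorem _root_.ContDiffOn.differentiableAt_of_isOpen {f : ℝ → ℝ} {I : Set ℝ}
    (hf : ContDiffOn ℝ ∞ f I) (hI : IsOpen I) {t : ℝ} (ht : t ∈ I) : DifferentiableAt ℝ f t :=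
  (hf.contDiffAt (hI.mem_nhds ht)).differentiableAt (by simp)

section Curve

open Matrix

variable {n : ℕ}
  {M : Type*} [TopologicalSpace M]

/-- A smooth regular curve with open domain `I`, contained in the domain of a chart. -/
structure IsRegularInChart (e : OpenPartialHomeomorph M (EuclideanSpace ℝ (Fin n))) (γ : ℝ → M)
    (I : Set ℝ) : Prop where
  isOpen : IsOpen I
  mem_source : ∀ t ∈ I, γ t ∈ e.source
  contDiffOn : ContDiffOn ℝ ∞ (fun t => e (γ t)) I
  velocity_ne_zero : ∀ t ∈ I, velocity e γ t ≠ 0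

variable {e : OpenPartialHomeomorph M (EuclideanSpace ℝ (Fin n))} {γ : ℝ → M} {I : Set ℝ}

theorem IsRegularInChart.contDiffOn_comp (h : IsRegularInChart e γ I)
    {f : EuclideanSpace ℝ (Fin n) → ℝ} (hf : ContDiffOn ℝ ∞ f e.target) :
    ContDiffOn ℝ ∞ (fun t => f (e (γ t))) I :=
  hf.comp h.contDiffOn fun t ht => e.map_source (h.mem_source t ht)

theorem IsRegularInChart.contDiffOn_coord (h : IsRegularInChart e γ I) (i : Fin n) :
    ContDiffOn ℝ ∞ (fun t => e (γ t) i) I :=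
  (contDiffOn_euclidean.1 h.contDiffOn) i

theorem IsRegularInChart.contDiffOn_velocity (h : IsRegularInChart e γ I) (i : Fin n) :
    ContDiffOn ℝ ∞ (fun t => velocity e γ t i) I :=
  (h.contDiffOn_coord i).deriv_of_isOpen h.isOpen (by simp)

theorem IsRegularInChart.hasDerivAt (h : IsRegularInChart e γ I) {t : ℝ} (ht : t ∈ I) :
    HasDerivAt (fun r => e (γ r)) (WithLp.toLp 2 (velocity e γ t)) t := by
  have h1 : HasDerivAt (fun r i => e (γ r) i) (velocity e γ t) t :=
    hasDerivAt_pi.2 fun i =>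
      ((h.contDiffOn_coord i).differentiableAt_of_isOpen h.isOpen ht).hasDerivAt
  exact (PiLp.continuousLinearEquiv 2 ℝ (fun _ : Fin n => ℝ)).symm.hasFDerivAt.comp_hasDerivAt t h1

theorem IsRegularInChart.hasDerivAt_comp (h : IsRegularInChart e γ I)
    {f : EuclideanSpace ℝ (Fin n) → ℝ} (hf : ContDiffOn ℝ ∞ f e.target) {t : ℝ} (ht : t ∈ I) :
    HasDerivAt (fun r => f (e (γ r)))
      (∑ k, velocity e γ t k * partialDeriv (e (γ t)) k f) t := by
  have hy := e.map_source (h.mem_source t ht)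
  have hd : DifferentiableAt ℝ f (e (γ t)) :=
    (hf.contDiffAt (e.open_target.mem_nhds hy)).differentiableAt (by simp)
  have h1 := hd.hasFDerivAt.comp_hasDerivAt t (h.hasDerivAt ht)
  refine h1.congr_deriv ?_
  have : (WithLp.toLp 2 (velocity e γ t) : EuclideanSpace ℝ (Fin n))
      = ∑ k, velocity e γ t k • EuclideanSpace.single k (1 : ℝ) := by
    ext k
    simp [Finset.sum_apply, Pi.single_apply]
  rw [this, map_sum]
  simp [partialDeriv]

variable [ChartedSpace (EuclideanSpace ℝ (Fin n)) M] [IsManifold (𝓡 n) ∞ M]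
  (g : Metric n M)

theorem tractorMetric_eq_dotProduct (y : EuclideanSpace ℝ (Fin n)) (A B : Tractor n) :
    tractorMetric g e y A B =
      A.mid ⬝ᵥ metricMatrix g e y *ᵥ B.mid + A.top * B.bot + A.bot * B.top := by
  simp only [tractorMetric, dotProduct, mulVec, Finset.mul_sum]
  congr 2
  refine Finset.sum_congr rfl fun i _ => Finset.sum_congr rfl fun j _ => ?_
  ring

theorem dotProduct_metricMatrix_comm (y : EuclideanSpace ℝ (Fin n)) (a b : Fin n → ℝ) :
    a ⬝ᵥ metricMatrix g e y *ᵥ b = b ⬝ᵥ metricMatrix g e y *ᵥ a := by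
  rw [dotProduct_mulVec, dotProduct_comm, ← mulVec_transpose, (metricMatrix_isSymm g y).eq]

theorem tractorMetric_comm (y : EuclideanSpace ℝ (Fin n)) (A B : Tractor n) :
    tractorMetric g e y A B = tractorMetric g e y B A := by
  simp only [tractorMetric_eq_dotProduct]
  rw [dotProduct_metricMatrix_comm]
  ring

theorem tractorMetric_add_left (y : EuclideanSpace ℝ (Fin n)) (A B C : Tractor n) :
    tractorMetric g e y (A + B) C = tractorMetric g e y A C + tractorMetric g e y B C := by
  simp only [tractorMetric_eq_dotProduct, Tractor.add_top, Tractor.add_mid, Tractor.add_bot,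
    add_dotProduct]
  ring

theorem tractorMetric_smul_left (y : EuclideanSpace ℝ (Fin n)) (c : ℝ) (A B : Tractor n) :
    tractorMetric g e y (c • A) B = c * tractorMetric g e y A B := by
  simp only [tractorMetric_eq_dotProduct, Tractor.smul_top, Tractor.smul_mid, Tractor.smul_bot,
    smul_dotProduct, smul_eq_mul]
  ring

theorem tractorMetric_add_right (y : EuclideanSpace ℝ (Fin n)) (A B C : Tractor n) :
    tractorMetric g e y A (B + C) = tractorMetric g e y A B + tractorMetric g e y A C := by
  simp only [tractorMetric_comm g y A, tractorMetric_add_left]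

theorem tractorMetric_smul_right (y : EuclideanSpace ℝ (Fin n)) (c : ℝ) (A B : Tractor n) :
    tractorMetric g e y A (c • B) = c * tractorMetric g e y A B := by
  simp only [tractorMetric_comm g y A, tractorMetric_smul_left]

/-- The connection matrix `Γ^k_ij U^i` along the curve. -/
noncomputable def connectionMatrix (e : OpenPartialHomeomorph M (EuclideanSpace ℝ (Fin n)))
    (γ : ℝ → M) (t : ℝ) : Matrix (Fin n) (Fin n) ℝ :=
  Matrix.of fun k j => ∑ i, christoffel g e (e (γ t)) k i j * velocity e γ t i

/-- The vector `U^i P_i^k` along the curve. -/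
noncomputable def schoutenVelocity (e : OpenPartialHomeomorph M (EuclideanSpace ℝ (Fin n)))
    (γ : ℝ → M) (t : ℝ) (k : Fin n) : ℝ :=
  ∑ i, velocity e γ t i * schoutenRaised g e (e (γ t)) i k

theorem tractorDeriv_top (A : ℝ → Tractor n) (t : ℝ) :
    (tractorDeriv g e γ A t).top = deriv (fun r => (A r).top) t
      - velocity e γ t ⬝ᵥ metricMatrix g e (e (γ t)) *ᵥ (A t).mid := by
  simp only [tractorDeriv, dotProduct, mulVec, Finset.mul_sum]
  congr 1
  refine Finset.sum_congr rfl fun i _ => Finset.sum_congr rfl fun j _ => ?_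
  ring

theorem tractorDeriv_mid (A : ℝ → Tractor n) (t : ℝ) :
    (tractorDeriv g e γ A t).mid = (fun k => deriv (fun r => (A r).mid k) t)
      + connectionMatrix g e γ t *ᵥ (A t).mid + (A t).bot • velocity e γ t
      + (A t).top • schoutenVelocity g e γ t := by
  ext k
  simp only [tractorDeriv, connectionMatrix, schoutenVelocity, mulVec, dotProduct, Pi.add_apply,
    Pi.smul_apply, smul_eq_mul, Matrix.of_apply, Finset.sum_mul,
    Finset.mul_sum]
  rw [Finset.sum_comm]
  simp only [mul_comm (A t).top, mul_comm (A t).bot]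

/-- Writing `P_ij` as `P_i^k g_kj` expresses the bottom slot through the same vector
`schoutenVelocity` as the middle slot, so that the two can cancel in the metric. -/
theorem tractorDeriv_bot (he : e ∈ IsManifold.maximalAtlas (𝓡 n) ∞ M) {t : ℝ}
    (ht : γ t ∈ e.source) (A : ℝ → Tractor n) :
    (tractorDeriv g e γ A t).bot = deriv (fun r => (A r).bot) t
      - schoutenVelocity g e γ t ⬝ᵥ metricMatrix g e (e (γ t)) *ᵥ (A t).mid := by
  simp only [tractorDeriv, ← sum_schoutenRaised_mul_metricMatrix g he (e.map_source ht),
    dotProduct, mulVec, Finset.mul_sum, schoutenVelocity, Finset.sum_mul]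
  congr 1
  conv_lhs => enter [2, i]; rw [Finset.sum_comm]
  rw [Finset.sum_comm]
  refine Finset.sum_congr rfl fun k _ => ?_
  rw [Finset.sum_comm]
  refine Finset.sum_congr rfl fun i _ => Finset.sum_congr rfl fun j _ => ?_
  ring

/-- This is metric compatibility of the Levi-Civita connection, contracted with the velocity. -/
theorem IsRegularInChart.hasDerivAt_metricMatrix (h : IsRegularInChart e γ I)
    (he : e ∈ IsManifold.maximalAtlas (𝓡 n) ∞ M) {t : ℝ} (ht : t ∈ I) (i j : Fin n) :
    HasDerivAt (fun r => metricMatrix g e (e (γ r)) i j)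
      (((connectionMatrix g e γ t)ᵀ * metricMatrix g e (e (γ t))
        + metricMatrix g e (e (γ t)) * connectionMatrix g e γ t) i j) t := by
  convert h.hasDerivAt_comp (contDiffOn_metricMatrix g he i j) ht using 1
  have hs := fun l => (metricMatrix_isSymm (e := e) g (e (γ t))).apply j l
  simp only [partialDeriv_metricMatrix g he (e.map_source (h.mem_source t ht)), Matrix.add_apply,
    Matrix.mul_apply, Matrix.transpose_apply, connectionMatrix, Matrix.of_apply, mul_add,
    Finset.sum_add_distrib, Finset.mul_sum, Finset.sum_mul]
  congr 1
  · rw [Finset.sum_comm]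
    refine Finset.sum_congr rfl fun i _ => Finset.sum_congr rfl fun l _ => ?_
    rw [hs]
    ring
  · rw [Finset.sum_comm]
    refine Finset.sum_congr rfl fun i _ => Finset.sum_congr rfl fun l _ => ?_
    ring

/-- The tractor connection preserves the tractor metric. -/
theorem IsRegularInChart.hasDerivAt_tractorMetric (h : IsRegularInChart e γ I)
    (he : e ∈ IsManifold.maximalAtlas (𝓡 n) ∞ M) {A B : ℝ → Tractor n} (hA : Tractor.SmoothOn A I)
    (hB : Tractor.SmoothOn B I) {t : ℝ} (ht : t ∈ I) :
    HasDerivAt (fun r => tractorMetric g e (e (γ r)) (A r) (B r))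
      (tractorMetric g e (e (γ t)) (tractorDeriv g e γ A t) (B t)
        + tractorMetric g e (e (γ t)) (A t) (tractorDeriv g e γ B t)) t := by
  have hd : ∀ {f : ℝ → ℝ}, ContDiffOn ℝ ∞ f I → HasDerivAt f (deriv f t) t :=
    fun hf => (hf.differentiableAt_of_isOpen h.isOpen ht).hasDerivAt
  have key := ((HasDerivAt.fun_sum fun i (_ : i ∈ Finset.univ) => HasDerivAt.fun_sum
      fun j (_ : j ∈ Finset.univ) =>
        ((h.hasDerivAt_metricMatrix g he ht i j).mul (hd (hA.mid i))).mul (hd (hB.mid j))).add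
    ((hd hA.top).mul (hd hB.bot))).add ((hd hA.bot).mul (hd hB.top))
  refine key.congr_deriv ?_
  simp only [tractorMetric_eq_dotProduct, tractorDeriv_top, tractorDeriv_mid,
    tractorDeriv_bot g he (h.mem_source t ht)]
  set G := metricMatrix g e (e (γ t)) with hG
  set C := connectionMatrix g e γ t
  set v := velocity e γ t
  set p := schoutenVelocity g e γ t
  set a := (A t).mid with ha
  set b := (B t).mid
  set a' : Fin n → ℝ := fun k => deriv (fun r => (A r).mid k) t
  set b' : Fin n → ℝ := fun k => deriv (fun r => (B r).mid k) t
  have hsum : ∑ i, ∑ j, (((Cᵀ * G + G * C) i j * a i + G i j * a' i) * b j + G i j * a i * b' j)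
      = a ⬝ᵥ (Cᵀ * G + G * C) *ᵥ b + a' ⬝ᵥ G *ᵥ b + a ⬝ᵥ G *ᵥ b' := by
    simp only [dotProduct, mulVec, Finset.mul_sum, ← Finset.sum_add_distrib]
    refine Finset.sum_congr rfl fun i _ => Finset.sum_congr rfl fun j _ => ?_
    ring
  have h1 : a ⬝ᵥ Cᵀ *ᵥ (G *ᵥ b) = C *ᵥ a ⬝ᵥ G *ᵥ b := by
    rw [dotProduct_mulVec, vecMul_transpose]
  have h2 : a ⬝ᵥ G *ᵥ v = v ⬝ᵥ G *ᵥ a := dotProduct_metricMatrix_comm g _ _ _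
  have h3 : a ⬝ᵥ G *ᵥ p = p ⬝ᵥ G *ᵥ a := dotProduct_metricMatrix_comm g _ _ _
  simp only [Pi.mul_apply, ← hG, ← ha] at hsum ⊢
  refine (congrArg (fun x => x + _ + _) hsum).trans ?_
  -- The terms in `C` reproduce the derivative of `G`. Those in `v` cancel between middle and top
  -- slots, those in `p` between middle and bottom slots.
  simp only [add_mulVec, ← mulVec_mulVec, dotProduct_add, add_dotProduct, mulVec_add, mulVec_smul,
    dotProduct_smul, smul_dotProduct, smul_eq_mul, h1, h2, h3]
  ring

end Curve
end ConformalCurve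

/-! ### The tractors `𝐓`, `𝐔`, `𝐔'`, `𝐔''`: smoothness, scalar products, and the sign of `Φ`. -/

namespace ConformalCurve

section CurveInvariants

open Matrix

variable {n : ℕ}
  {M : Type*} [TopologicalSpace M]
  {e : OpenPartialHomeomorph M (EuclideanSpace ℝ (Fin n))} {γ : ℝ → M} {I : Set ℝ}

theorem IsRegularInChart.mono (h : IsRegularInChart e γ I) {I' : Set ℝ} (hI' : IsOpen I')
    (hsub : I' ⊆ I) : IsRegularInChart e γ I' :=
  ⟨hI', fun t ht => h.mem_source t (hsub ht), h.contDiffOn.mono hsub,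
    fun t ht => h.velocity_ne_zero t (hsub ht)⟩

theorem IsRegularInChart.velocity_reparam (h : IsRegularInChart e γ I) {δ : ℝ → M} {τ : ℝ → ℝ}
    {τ' r : ℝ} (hτ : HasDerivAt τ τ' r) (hr : τ r ∈ I) (hδ : δ =ᶠ[𝓝 r] fun r => γ (τ r)) :
    velocity e δ r = τ' • velocity e γ (τ r) := by
  ext i
  have h1 := ((h.contDiffOn_coord i).differentiableAt_of_isOpen h.isOpen hr).hasDerivAt
  have h2 : (fun r => e (δ r) i) =ᶠ[𝓝 r] (fun t => e (γ t) i) ∘ τ := by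
    filter_upwards [hδ] with x hx
    simp [hx]
  rw [velocity, h2.deriv_eq, (h1.comp r hτ).deriv, Pi.smul_apply, smul_eq_mul, mul_comm]
  rfl

variable [ChartedSpace (EuclideanSpace ℝ (Fin n)) M]

/-- Transfers intrinsic regularity to coordinates: locally `γ = e.symm ∘ (e ∘ γ)`, so vanishing
coordinate velocity would kill the differential of `γ`. -/
theorem isRegularInChart_of_contMDiffOn (he : e ∈ IsManifold.maximalAtlas (𝓡 n) ∞ M)
    {J : Set ℝ} (hJ : IsOpen J) (hγ : ContMDiffOn 𝓘(ℝ, ℝ) (𝓡 n) ∞ γ J)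
    (hreg : ∀ t ∈ J, mfderiv 𝓘(ℝ, ℝ) (𝓡 n) γ t (1 : ℝ) ≠ 0) :
    IsRegularInChart e γ (J ∩ γ ⁻¹' e.source) := by
  have hopen : IsOpen (J ∩ γ ⁻¹' e.source) :=
    hγ.continuousOn.isOpen_inter_preimage hJ e.open_source
  have hsm : ContDiffOn ℝ ∞ (fun t => e (γ t)) (J ∩ γ ⁻¹' e.source) :=
    contMDiffOn_iff_contDiffOn.1 ((contMDiffOn_of_mem_maximalAtlas he).comp
      (hγ.mono Set.inter_subset_left) Set.inter_subset_right)
  refine ⟨hopen, fun t ht => ht.2, hsm, fun t ht h0 => hreg t ht.1 ?_⟩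
  have hd : DifferentiableAt ℝ (fun t => e (γ t)) t :=
    (hsm.contDiffAt (hopen.mem_nhds ht)).differentiableAt (by simp)
  have hder : HasDerivAt (fun t => e (γ t)) 0 t := by
    have h1 : deriv (fun t => e (γ t)) t = 0 := by
      ext i
      have h2 := ((EuclideanSpace.proj (𝕜 := ℝ) i).hasFDerivAt.comp_hasDerivAt t
        hd.hasDerivAt).deriv
      exact h2.symm.trans (congrFun h0 i)
    exact h1 ▸ hd.hasDerivAt
  have hsymm : HasMFDerivAt (𝓡 n) (𝓡 n) e.symm (e (γ t))
      (mfderiv (𝓡 n) (𝓡 n) e.symm (e (γ t))) :=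
    ((chart_mdifferentiable he).symm.mdifferentiableAt (e.map_source ht.2)).hasMFDerivAt
  have hcomp := hsymm.comp t hder.hasFDerivAt.hasMFDerivAt
  have heq : γ =ᶠ[𝓝 t] e.symm ∘ fun t => e (γ t) := by
    filter_upwards [hopen.mem_nhds ht] with r hr
    exact (e.left_inv hr.2).symm
  rw [heq.mfderiv_eq, hcomp.mfderiv, ContinuousLinearMap.toSpanSingleton_zero]
  exact map_zero (mfderiv (𝓡 n) (𝓡 n) e.symm (e (γ t)))

variable [IsManifold (𝓡 n) ∞ M] (g : Metric n M)

theorem speed_eq (t : ℝ) : speed g e γ t =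
    √(velocity e γ t ⬝ᵥ metricMatrix g e (e (γ t)) *ᵥ velocity e γ t) := by
  simp only [speed, dotProduct, mulVec, Finset.mul_sum]
  congr 1
  refine Finset.sum_congr rfl fun i _ => Finset.sum_congr rfl fun j _ => ?_
  ring

variable (he : e ∈ IsManifold.maximalAtlas (𝓡 n) ∞ M)

include he in
theorem IsRegularInChart.velocity_sq_pos (h : IsRegularInChart e γ I) {t : ℝ} (ht : t ∈ I) :
    0 < velocity e γ t ⬝ᵥ metricMatrix g e (e (γ t)) *ᵥ velocity e γ t := by
  simpa using (metricMatrix_posDef g he (e.map_source (h.mem_source t ht))).dotProduct_mulVec_pos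
    (h.velocity_ne_zero t ht)

include he in
theorem IsRegularInChart.speed_pos (h : IsRegularInChart e γ I) {t : ℝ} (ht : t ∈ I) :
    0 < speed g e γ t := by
  rw [speed_eq]
  exact Real.sqrt_pos.2 (h.velocity_sq_pos g he ht)

include he in
theorem IsRegularInChart.speed_sq (h : IsRegularInChart e γ I) {t : ℝ} (ht : t ∈ I) :
    velocity e γ t ⬝ᵥ metricMatrix g e (e (γ t)) *ᵥ velocity e γ t = speed g e γ t ^ 2 := by
  rw [speed_eq, Real.sq_sqrt (h.velocity_sq_pos g he ht).le]

include he in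
theorem IsRegularInChart.contDiffOn_tractorMetric (h : IsRegularInChart e γ I)
    {A B : ℝ → Tractor n} (hA : Tractor.SmoothOn A I) (hB : Tractor.SmoothOn B I) :
    ContDiffOn ℝ ∞ (fun t => tractorMetric g e (e (γ t)) (A t) (B t)) I :=
  ((ContDiffOn.sum fun i _ => ContDiffOn.sum fun j _ =>
    ((h.contDiffOn_comp (contDiffOn_metricMatrix g he i j)).mul (hA.mid i)).mul (hB.mid j)).add
    (hA.top.mul hB.bot)).add (hA.bot.mul hB.top)

include he in
theorem IsRegularInChart.contDiffOn_speed (h : IsRegularInChart e γ I) :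
    ContDiffOn ℝ ∞ (speed g e γ) I := by
  refine ContDiffOn.sqrt (ContDiffOn.sum fun i _ => ContDiffOn.sum fun j _ =>
    ((h.contDiffOn_comp (contDiffOn_metricMatrix g he i j)).mul (h.contDiffOn_velocity i)).mul
      (h.contDiffOn_velocity j)) fun t ht h0 => ?_
  have h1 := h.speed_pos g he ht
  rw [speed, h0] at h1
  simp at h1

include he in
theorem IsRegularInChart.smoothOn_tractorDeriv (h : IsRegularInChart e γ I)
    {A : ℝ → Tractor n} (hA : Tractor.SmoothOn A I) :
    Tractor.SmoothOn (tractorDeriv g e γ A) I where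
  top := (hA.top.deriv_of_isOpen h.isOpen (by simp)).sub (ContDiffOn.sum fun i _ =>
    ContDiffOn.sum fun j _ => ((h.contDiffOn_comp (contDiffOn_metricMatrix g he i j)).mul
      (h.contDiffOn_velocity i)).mul (hA.mid j))
  mid k := ((((hA.mid k).deriv_of_isOpen h.isOpen (by simp)).add (ContDiffOn.sum fun i _ =>
    ContDiffOn.sum fun j _ => ((h.contDiffOn_comp (contDiffOn_christoffel g he k i j)).mul
      (h.contDiffOn_velocity i)).mul (hA.mid j))).add ((h.contDiffOn_velocity k).mul hA.bot)).add
    ((ContDiffOn.sum fun i _ => (h.contDiffOn_velocity i).mul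
      (h.contDiffOn_comp (contDiffOn_schoutenRaised g he i k))).mul hA.top)
  bot := (hA.bot.deriv_of_isOpen h.isOpen (by simp)).sub (ContDiffOn.sum fun i _ =>
    ContDiffOn.sum fun j _ => ((h.contDiffOn_comp (contDiffOn_schouten g he i j)).mul
      (h.contDiffOn_velocity i)).mul (hA.mid j))

include he in
theorem IsRegularInChart.smoothOn_tractorT (h : IsRegularInChart e γ I) :
    Tractor.SmoothOn (tractorT g e γ) I :=
  ⟨contDiffOn_const, fun _ => contDiffOn_const,
    (h.contDiffOn_speed g he).inv fun _ ht => (h.speed_pos g he ht).ne'⟩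

include he in
theorem IsRegularInChart.smoothOn_tractorU (h : IsRegularInChart e γ I) :
    Tractor.SmoothOn (tractorU g e γ) I :=
  h.smoothOn_tractorDeriv g he (h.smoothOn_tractorT g he)

include he in
theorem IsRegularInChart.smoothOn_tractorU' (h : IsRegularInChart e γ I) :
    Tractor.SmoothOn (tractorU' g e γ) I :=
  h.smoothOn_tractorDeriv g he (h.smoothOn_tractorU g he)

include he in
theorem IsRegularInChart.smoothOn_tractorU'' (h : IsRegularInChart e γ I) :
    Tractor.SmoothOn (tractorU'' g e γ) I :=
  h.smoothOn_tractorDeriv g he (h.smoothOn_tractorU' g he)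

include he in
theorem IsRegularInChart.contDiffOn_Phi (h : IsRegularInChart e γ I) :
    ContDiffOn ℝ ∞ (Phi g e γ) I :=
  (h.contDiffOn_tractorMetric g he (h.smoothOn_tractorU'' g he) (h.smoothOn_tractorU'' g he)).sub
    ((h.contDiffOn_tractorMetric g he (h.smoothOn_tractorU' g he)
      (h.smoothOn_tractorU' g he)).pow 2)

include he in
/-- Differentiating a constant scalar product of two tractor fields. -/
theorem IsRegularInChart.tractorMetric_deriv_of_const (h : IsRegularInChart e γ I)
    {A B : ℝ → Tractor n} (hA : Tractor.SmoothOn A I) (hB : Tractor.SmoothOn B I) {c : ℝ}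
    (hc : ∀ t ∈ I, tractorMetric g e (e (γ t)) (A t) (B t) = c) {t : ℝ} (ht : t ∈ I) :
    tractorMetric g e (e (γ t)) (tractorDeriv g e γ A t) (B t)
      + tractorMetric g e (e (γ t)) (A t) (tractorDeriv g e γ B t) = 0 := by
  have h1 := h.hasDerivAt_tractorMetric g he hA hB ht
  have h2 : (fun r => tractorMetric g e (e (γ r)) (A r) (B r)) =ᶠ[𝓝 t] fun _ => c := by
    filter_upwards [h.isOpen.mem_nhds ht] with r hr using hc r hr
  exact h1.unique ((hasDerivAt_const t c).congr_of_eventuallyEq h2)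

/-- Since `𝐓` lives in the bottom slot, pairing with it reads off the top slot. Where the speed is
positive, orthogonality to `𝐓` thus means a vanishing top slot. -/
theorem tractorMetric_tractorT (t : ℝ) (A : Tractor n) :
    tractorMetric g e (e (γ t)) (tractorT g e γ t) A = (speed g e γ t)⁻¹ * A.top := by
  simp [tractorMetric, tractorT]

theorem tractorU_top (t : ℝ) : (tractorU g e γ t).top = 0 := by
  simp [tractorU, tractorDeriv, tractorT]

theorem tractorU_mid (t : ℝ) :
    (tractorU g e γ t).mid = (speed g e γ t)⁻¹ • velocity e γ t := by
  ext k
  simp [tractorU, tractorDeriv, tractorT, mul_comm]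

theorem tractorMetric_T_T (t : ℝ) :
    tractorMetric g e (e (γ t)) (tractorT g e γ t) (tractorT g e γ t) = 0 := by
  rw [tractorMetric_tractorT]
  simp [tractorT]

theorem tractorMetric_T_U (t : ℝ) :
    tractorMetric g e (e (γ t)) (tractorT g e γ t) (tractorU g e γ t) = 0 := by
  rw [tractorMetric_tractorT, tractorU_top, mul_zero]

include he in
-- The middle slot of `𝐔` is the unit tangent vector, and its bottom slot is multiplied by the zero
-- top slot.
theorem IsRegularInChart.tractorMetric_U_U (h : IsRegularInChart e γ I) {t : ℝ} (ht : t ∈ I) :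
    tractorMetric g e (e (γ t)) (tractorU g e γ t) (tractorU g e γ t) = 1 := by
  have hu := (h.speed_pos g he ht).ne'
  rw [tractorMetric_eq_dotProduct, tractorU_top, tractorU_mid, mulVec_smul, smul_dotProduct,
    dotProduct_smul, h.speed_sq g he ht]
  simp only [smul_eq_mul]
  field_simp
  ring

include he in
theorem IsRegularInChart.tractorMetric_T_U' (h : IsRegularInChart e γ I) {t : ℝ} (ht : t ∈ I) :
    tractorMetric g e (e (γ t)) (tractorT g e γ t) (tractorU' g e γ t) = -1 := by
  have h1 := h.tractorMetric_deriv_of_const g he (h.smoothOn_tractorT g he)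
    (h.smoothOn_tractorU g he) (fun t _ => tractorMetric_T_U g t) ht
  have h2 := h.tractorMetric_U_U g he ht
  change tractorMetric g e (e (γ t)) (tractorU g e γ t) (tractorU g e γ t)
    + tractorMetric g e (e (γ t)) (tractorT g e γ t) (tractorU' g e γ t) = 0 at h1
  linarith

include he in
theorem IsRegularInChart.tractorMetric_U_U' (h : IsRegularInChart e γ I) {t : ℝ} (ht : t ∈ I) :
    tractorMetric g e (e (γ t)) (tractorU g e γ t) (tractorU' g e γ t) = 0 := by
  have h1 := h.tractorMetric_deriv_of_const g he (h.smoothOn_tractorU g he)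
    (h.smoothOn_tractorU g he) (fun t ht => h.tractorMetric_U_U g he ht) ht
  change tractorMetric g e (e (γ t)) (tractorU' g e γ t) (tractorU g e γ t)
    + tractorMetric g e (e (γ t)) (tractorU g e γ t) (tractorU' g e γ t) = 0 at h1
  rw [tractorMetric_comm] at h1
  linarith

include he in
-- Differentiating `⟨𝐓,𝐔'⟩ = -1` and using `⟨𝐔,𝐔'⟩ = 0` gives `⟨𝐓,𝐔''⟩ = 0`.
theorem IsRegularInChart.tractorU''_top (h : IsRegularInChart e γ I) {t : ℝ} (ht : t ∈ I) :
    (tractorU'' g e γ t).top = 0 := by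
  have h1 := h.tractorMetric_deriv_of_const g he (h.smoothOn_tractorT g he)
    (h.smoothOn_tractorU' g he) (fun t ht => h.tractorMetric_T_U' g he ht) ht
  change tractorMetric g e (e (γ t)) (tractorU g e γ t) (tractorU' g e γ t)
    + tractorMetric g e (e (γ t)) (tractorT g e γ t) (tractorU'' g e γ t) = 0 at h1
  rw [h.tractorMetric_U_U' g he ht, tractorMetric_tractorT] at h1
  simpa [(h.speed_pos g he ht).ne'] using h1

include he in
theorem IsRegularInChart.tractorMetric_U_U'' (h : IsRegularInChart e γ I) {t : ℝ} (ht : t ∈ I) :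
    tractorMetric g e (e (γ t)) (tractorU g e γ t) (tractorU'' g e γ t) = -alpha g e γ t := by
  have h1 := h.tractorMetric_deriv_of_const g he (h.smoothOn_tractorU g he)
    (h.smoothOn_tractorU' g he) (fun t ht => h.tractorMetric_U_U' g he ht) ht
  change alpha g e γ t
    + tractorMetric g e (e (γ t)) (tractorU g e γ t) (tractorU'' g e γ t) = 0 at h1
  linarith

include he in
/-- `Φ` is nonnegative: with `V = 𝐔'' + α 𝐔`, which is orthogonal to `𝐓`, one has
`Φ = ⟨V, V⟩`. -/
theorem IsRegularInChart.Phi_nonneg (h : IsRegularInChart e γ I) {t : ℝ} (ht : t ∈ I) :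
    0 ≤ Phi g e γ t := by
  -- As `⟨𝐔,𝐔''⟩ = -α` and `⟨𝐔,𝐔⟩ = 1`, this is `𝐔''` minus its projection to `𝐔`.
  set V : Tractor n := tractorU'' g e γ t + alpha g e γ t • tractorU g e γ t with hV
  have htop : V.top = 0 := by
    simp [hV, h.tractorU''_top g he ht, tractorU_top]
  have hPhi : Phi g e γ t = tractorMetric g e (e (γ t)) V V := by
    have h1 := h.tractorMetric_U_U'' g he ht
    have h2 := h.tractorMetric_U_U g he ht
    simp only [hV, tractorMetric_add_left, tractorMetric_add_right, tractorMetric_smul_left,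
      tractorMetric_smul_right, tractorMetric_comm g _ (tractorU'' g e γ t) (tractorU g e γ t),
      h1, h2, Phi]
    ring
  rw [hPhi, tractorMetric_eq_dotProduct, htop, zero_mul, mul_zero, add_zero, add_zero]
  simpa using (metricMatrix_posDef g he
    (e.map_source (h.mem_source t ht))).posSemidef.dotProduct_mulVec_nonneg V.mid

theorem IsRegularInChart.tractorDeriv_add (h : IsRegularInChart e γ I) {A B : ℝ → Tractor n}
    (hA : Tractor.SmoothOn A I) (hB : Tractor.SmoothOn B I) {t : ℝ} (ht : t ∈ I) :
    tractorDeriv g e γ (fun r => A r + B r) t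
      = tractorDeriv g e γ A t + tractorDeriv g e γ B t := by
  have hd : ∀ {f : ℝ → ℝ}, ContDiffOn ℝ ∞ f I → DifferentiableAt ℝ f t :=
    fun hf => hf.differentiableAt_of_isOpen h.isOpen ht
  ext
  · simp only [tractorDeriv, Tractor.add_top, Tractor.add_mid, Pi.add_apply,
      deriv_fun_add (hd hA.top) (hd hB.top), mul_add, Finset.sum_add_distrib]
    ring
  · rename_i k
    simp only [tractorDeriv, Tractor.add_top, Tractor.add_mid, Tractor.add_bot, Pi.add_apply,
      deriv_fun_add (hd (hA.mid k)) (hd (hB.mid k)), mul_add, Finset.sum_add_distrib]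
    ring
  · simp only [tractorDeriv, Tractor.add_bot, Tractor.add_mid, Pi.add_apply,
      deriv_fun_add (hd hA.bot) (hd hB.bot), mul_add, Finset.sum_add_distrib]
    ring

theorem IsRegularInChart.tractorDeriv_smul (h : IsRegularInChart e γ I) {f : ℝ → ℝ}
    {A : ℝ → Tractor n} (hf : ContDiffOn ℝ ∞ f I) (hA : Tractor.SmoothOn A I) {t : ℝ}
    (ht : t ∈ I) :
    tractorDeriv g e γ (fun r => f r • A r) t
      = deriv f t • A t + f t • tractorDeriv g e γ A t := by
  have hd : ∀ {f : ℝ → ℝ}, ContDiffOn ℝ ∞ f I → DifferentiableAt ℝ f t :=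
    fun hf => hf.differentiableAt_of_isOpen h.isOpen ht
  have hsum : ∀ F : Fin n → Fin n → ℝ, ∑ i, ∑ j, F i j * (f t * (A t).mid j)
      = f t * ∑ i, ∑ j, F i j * (A t).mid j := fun F => by
    simp only [Finset.mul_sum]
    refine Finset.sum_congr rfl fun i _ => Finset.sum_congr rfl fun j _ => ?_
    ring
  ext
  · simp only [tractorDeriv, Tractor.add_top, Tractor.smul_top, Tractor.smul_mid, Pi.smul_apply,
      deriv_fun_mul (hd hf) (hd hA.top), smul_eq_mul, hsum]
    ring
  · rename_i k
    simp only [tractorDeriv, Tractor.add_mid, Tractor.smul_top, Tractor.smul_mid,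
      Tractor.smul_bot, Pi.smul_apply, Pi.add_apply,
      deriv_fun_mul (hd hf) (hd (hA.mid k)), smul_eq_mul, hsum]
    ring
  · simp only [tractorDeriv, Tractor.add_bot, Tractor.smul_bot, Tractor.smul_mid, Pi.smul_apply,
      deriv_fun_mul (hd hf) (hd hA.bot), smul_eq_mul, hsum]
    ring

/-- The derivative of tractor fields along a reparametrized curve. -/
theorem IsRegularInChart.tractorDeriv_reparam (h : IsRegularInChart e γ I) {δ : ℝ → M}
    {τ : ℝ → ℝ} {τ' r : ℝ} (hτ : HasDerivAt τ τ' r) (hr : τ r ∈ I)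
    (hδ : δ =ᶠ[𝓝 r] fun r => γ (τ r)) {A B : ℝ → Tractor n} (hB : Tractor.SmoothOn B I)
    (hA : A =ᶠ[𝓝 r] fun r => B (τ r)) :
    tractorDeriv g e δ A r = τ' • tractorDeriv g e γ B (τ r) := by
  have hv := h.velocity_reparam hτ hr hδ
  have hd : ∀ {F : Tractor n → ℝ}, ContDiffOn ℝ ∞ (fun t => F (B t)) I →
      deriv (fun r => F (A r)) r = τ' * deriv (fun t => F (B t)) (τ r) := by
    intro F hF
    have h1 := (hF.differentiableAt_of_isOpen h.isOpen hr).hasDerivAt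
    have h2 : (fun r => F (A r)) =ᶠ[𝓝 r] (fun t => F (B t)) ∘ τ := by
      filter_upwards [hA] with x hx
      simp [hx]
    rw [h2.deriv_eq, (h1.comp r hτ).deriv, mul_comm]
  have hsum : ∀ F : Fin n → Fin n → ℝ,
      ∑ i, ∑ j, F i j * (τ' * velocity e γ (τ r) i) * (B (τ r)).mid j
        = τ' * ∑ i, ∑ j, F i j * velocity e γ (τ r) i * (B (τ r)).mid j := fun F => by
    simp only [Finset.mul_sum]
    refine Finset.sum_congr rfl fun i _ => Finset.sum_congr rfl fun j _ => ?_
    ring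
  ext
  · simp only [tractorDeriv, hd (F := Tractor.top) hB.top, hv, hA.eq_of_nhds, hδ.eq_of_nhds,
      Pi.smul_apply, smul_eq_mul, hsum fun i j => metricMatrix g e (e (γ (τ r))) i j,
      Tractor.smul_top]
    ring
  · rename_i k
    have hsum' : ∀ F : Fin n → ℝ, ∑ i, τ' * velocity e γ (τ r) i * F i
        = τ' * ∑ i, velocity e γ (τ r) i * F i := fun F => by
      simp only [Finset.mul_sum, mul_assoc]
    simp only [tractorDeriv, hd (F := fun X => X.mid k) (hB.mid k), hv, hA.eq_of_nhds,
      hδ.eq_of_nhds, Pi.smul_apply, smul_eq_mul, hsum, hsum', Tractor.smul_mid]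
    ring
  · simp only [tractorDeriv, hd (F := Tractor.bot) hB.bot, hv, hA.eq_of_nhds, hδ.eq_of_nhds,
      Pi.smul_apply, smul_eq_mul, hsum, Tractor.smul_bot]
    ring

end CurveInvariants
end ConformalCurve

/-! ### Arc-length parameters, change of parameter, and the formula for `K₁`. -/

namespace ConformalCurve

open Filter

theorem exists_eventually_hasDerivAt {p : ℝ → ℝ} {I : Set ℝ} (hI : IsOpen I)
    (hp : ContinuousOn p I) {t₀ : ℝ} (ht₀ : t₀ ∈ I) :
    ∃ s : ℝ → ℝ, ∀ᶠ t in 𝓝 t₀, HasDerivAt s (p t) t := by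
  -- `I` may be disconnected; a ball ensures that the whole interval of integration lies in `I`.
  obtain ⟨ε, hε, hball⟩ := _root_.Metric.isOpen_iff.1 hI t₀ ht₀
  refine ⟨fun t => ∫ x in t₀..t, p x, ?_⟩
  filter_upwards [_root_.Metric.ball_mem_nhds t₀ hε] with t ht
  have hsub : Set.uIcc t₀ t ⊆ I := fun x hx => hball
    ((convex_ball t₀ ε).ordConnected.uIcc_subset (_root_.Metric.mem_ball_self hε) ht hx)
  exact intervalIntegral.integral_hasDerivAt_right ((hp.mono hsub).intervalIntegrable)
    (hp.stronglyMeasurableAtFilter hI t (hball ht)) (hp.continuousAt (hI.mem_nhds (hball ht)))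

/-- Inverse function theorem, with strict differentiability coming from continuity of `p` at `t₀`.
The derivative of `τ` is needed on a neighbourhood, because tractor fields along the new curve are
differentiated repeatedly. -/
theorem exists_local_inverse {s p : ℝ → ℝ} {t₀ : ℝ}
    (hs : ∀ᶠ t in 𝓝 t₀, HasDerivAt s (p t) t) (hp : ContinuousAt p t₀) (h0 : p t₀ ≠ 0) :
    ∃ τ : ℝ → ℝ, τ (s t₀) = t₀ ∧ ContinuousAt τ (s t₀) ∧ (∀ᶠ t in 𝓝 t₀, τ (s t) = t) ∧
      ∀ᶠ r in 𝓝 (s t₀), s (τ r) = r ∧ HasDerivAt τ (p (τ r))⁻¹ r := by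
  have hstrict := (hasStrictDerivAt_of_hasDerivAt_of_continuousAt hs hp).hasStrictFDerivAt_equiv h0
  set P := hstrict.toOpenPartialHomeomorph with hP
  have hPs : ∀ t, P t = s t := fun t => rfl
  have hsrc : t₀ ∈ P.source := hstrict.mem_toOpenPartialHomeomorph_source
  have htgt : s t₀ ∈ P.target := P.map_source hsrc
  have hτ0 : P.symm (s t₀) = t₀ := P.left_inv hsrc
  have hcont : ContinuousAt P.symm (s t₀) := P.continuousAt_symm htgt
  refine ⟨P.symm, hτ0, hcont, ?_, ?_⟩
  · filter_upwards [P.open_source.mem_nhds hsrc] with t ht using P.left_inv ht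
  · have htend : Tendsto P.symm (𝓝 (s t₀)) (𝓝 t₀) := by
      simpa only [ContinuousAt, hτ0] using hcont
    filter_upwards [P.open_target.mem_nhds htgt, htend.eventually hs,
      htend.eventually (hp.eventually_ne h0)] with r hr hd hne
    exact ⟨P.right_inv hr, P.hasDerivAt_symm hr hne hd⟩

section

variable {n : ℕ}
  {M : Type*} [TopologicalSpace M] [ChartedSpace (EuclideanSpace ℝ (Fin n)) M]
  [IsManifold (𝓡 n) ∞ M] (g : Metric n M)
  {e : OpenPartialHomeomorph M (EuclideanSpace ℝ (Fin n))} {γ : ℝ → M} {I : Set ℝ}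

/-- The behaviour of `α = ⟨𝐔', 𝐔'⟩` under a reparametrization with `ds = p dt`. -/
theorem IsRegularInChart.alpha_reparam (he : e ∈ IsManifold.maximalAtlas (𝓡 n) ∞ M)
    (h : IsRegularInChart e γ I) {p : ℝ → ℝ} (hp : ContDiffOn ℝ ∞ p I) (hpos : ∀ t ∈ I, 0 < p t)
    {δ : ℝ → M} {τ : ℝ → ℝ} {r₀ : ℝ} (hr₀ : τ r₀ ∈ I)
    (hτ : ∀ᶠ r in 𝓝 r₀, HasDerivAt τ (p (τ r))⁻¹ r) (hδ : ∀ᶠ r in 𝓝 r₀, δ r = γ (τ r)) :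
    alpha g e δ r₀ = (p (τ r₀))⁻¹ ^ 2 * (alpha g e γ (τ r₀)
      - 2 * deriv (fun t => (p t)⁻¹ * deriv p t) (τ r₀)
      + ((p (τ r₀))⁻¹ * deriv p (τ r₀)) ^ 2) := by
  set f : ℝ → ℝ := fun t => (p t)⁻¹ * deriv p t
  have hf : ContDiffOn ℝ ∞ f I :=
    (hp.inv fun t ht => (hpos t ht).ne').mul (hp.deriv_of_isOpen h.isOpen (by simp))
  have hT := h.smoothOn_tractorT g he
  have hU := h.smoothOn_tractorU g he
  have hI : ∀ᶠ r in 𝓝 r₀, τ r ∈ I :=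
    hτ.self_of_nhds.continuousAt.eventually_mem (h.isOpen.mem_nhds hr₀)
  -- The identities for `𝐓` and `𝐔` must hold near `r₀`, not only at it, since each is
  -- differentiated to obtain the next.
  have hTδ : ∀ᶠ r in 𝓝 r₀, tractorT g e δ r = p (τ r) • tractorT g e γ (τ r) := by
    filter_upwards [hτ, hI, hδ.eventually_nhds] with r hr hrI hδr
    have hq : 0 ≤ (p (τ r))⁻¹ := (inv_pos.2 (hpos _ hrI)).le
    have hspeed : speed g e δ r = (p (τ r))⁻¹ * speed g e γ (τ r) := by
      rw [speed_eq, speed_eq, h.velocity_reparam hr hrI hδr, hδr.self_of_nhds,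
        Matrix.mulVec_smul, smul_dotProduct, dotProduct_smul, smul_eq_mul, smul_eq_mul,
        ← mul_assoc, Real.sqrt_mul (mul_self_nonneg _), Real.sqrt_mul_self hq]
    ext <;> simp [tractorT, hspeed, mul_comm]
  have hUδ : ∀ᶠ r in 𝓝 r₀, tractorU g e δ r
      = f (τ r) • tractorT g e γ (τ r) + tractorU g e γ (τ r) := by
    filter_upwards [hτ, hI, hδ.eventually_nhds, hTδ.eventually_nhds] with r hr hrI hδr hTr
    have hne := (hpos _ hrI).ne'
    rw [tractorU, h.tractorDeriv_reparam g hr hrI hδr (.smul hp hT) hTr,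
      h.tractorDeriv_smul g hp hT hrI]
    ext
    · simp only [Tractor.smul_top, Tractor.add_top, tractorU, f]
      field_simp
    · simp only [Tractor.smul_mid, Tractor.add_mid, tractorU, f, Pi.smul_apply, Pi.add_apply,
        smul_eq_mul]
      field_simp
    · simp only [Tractor.smul_bot, Tractor.add_bot, tractorU, f]
      field_simp
  rw [alpha, tractorU', h.tractorDeriv_reparam g hτ.self_of_nhds hr₀ hδ ((hT.smul hf).add hU) hUδ,
    h.tractorDeriv_add g (hT.smul hf) hU hr₀, h.tractorDeriv_smul g hf hT hr₀, hδ.self_of_nhds]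
  change tractorMetric g e (e (γ (τ r₀)))
    ((p (τ r₀))⁻¹ • (deriv f (τ r₀) • tractorT g e γ (τ r₀) + f (τ r₀) • tractorU g e γ (τ r₀)
      + tractorU' g e γ (τ r₀)))
    ((p (τ r₀))⁻¹ • (deriv f (τ r₀) • tractorT g e γ (τ r₀) + f (τ r₀) • tractorU g e γ (τ r₀)
      + tractorU' g e γ (τ r₀))) = _
  -- Of the scalar products, only `⟨𝐔',𝐔'⟩ = α`, `⟨𝐓,𝐔'⟩ = -1` (occurring twice) and `⟨𝐔,𝐔⟩ = 1`
  -- survive, leaving `α - 2f' + f²`.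
  simp only [tractorMetric_smul_left, tractorMetric_smul_right, tractorMetric_add_left,
    tractorMetric_add_right, tractorMetric_comm g _ (tractorU g e γ (τ r₀)) (tractorT g e γ (τ r₀)),
    tractorMetric_comm g _ (tractorU' g e γ (τ r₀)) (tractorT g e γ (τ r₀)),
    tractorMetric_comm g _ (tractorU' g e γ (τ r₀)) (tractorU g e γ (τ r₀)),
    tractorMetric_T_T, tractorMetric_T_U, h.tractorMetric_U_U g he hr₀,
    h.tractorMetric_T_U' g he hr₀, h.tractorMetric_U_U' g he hr₀]
  rw [alpha]
  ring

/-- If `Φ` does not vanish at `t₀`, it is positive near `t₀`. -/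
theorem IsRegularInChart.exists_Phi_pos (he : e ∈ IsManifold.maximalAtlas (𝓡 n) ∞ M)
    (h : IsRegularInChart e γ I) {t₀ : ℝ} (ht₀ : t₀ ∈ I) (hΦ : Phi g e γ t₀ ≠ 0) :
    ∃ I' : Set ℝ, t₀ ∈ I' ∧ IsRegularInChart e γ I' ∧ ∀ t ∈ I', 0 < Phi g e γ t := by
  refine ⟨I ∩ Phi g e γ ⁻¹' Set.Ioi 0, ⟨ht₀, lt_of_le_of_ne (h.Phi_nonneg g he ht₀) hΦ.symm⟩,
    h.mono ?_ Set.inter_subset_left, fun t ht => ht.2⟩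
  exact (h.contDiffOn_Phi g he).continuousOn.isOpen_inter_preimage h.isOpen isOpen_Ioi

/-- The logarithmic derivative of a power of a positive function. -/
theorem inv_rpow_mul_deriv_rpow {φ : ℝ → ℝ} {t : ℝ} (c : ℝ) (hφ : DifferentiableAt ℝ φ t)
    (hpos : 0 < φ t) :
    (φ t ^ c)⁻¹ * deriv (fun r => φ r ^ c) t = c * deriv (fun r => Real.log (φ r)) t := by
  rw [(hφ.hasDerivAt.rpow_const (Or.inl hpos.ne')).deriv, (hφ.hasDerivAt.log hpos.ne').deriv,
    Real.rpow_sub_one hpos.ne']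
  have := (Real.rpow_pos_of_pos hpos c).ne'
  field_simp

theorem IsRegularInChart.isFirstConformalCurvatureAt_iff
    (he : e ∈ IsManifold.maximalAtlas (𝓡 n) ∞ M)
    (h : IsRegularInChart e γ I) (hpos : ∀ t ∈ I, 0 < Phi g e γ t) {t₀ : ℝ} (ht₀ : t₀ ∈ I)
    (K : ℝ) :
    IsFirstConformalCurvatureAt g e γ t₀ K ↔ K = -(1 / 2) * Phi g e γ t₀ ^ (-(1 / 2) : ℝ) *
        (alpha g e γ t₀ - 1 / 2 * deriv (deriv fun t => Real.log (Phi g e γ t)) t₀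
          + 1 / 16 * deriv (fun t => Real.log (Phi g e γ t)) t₀ ^ 2) := by
  set p : ℝ → ℝ := fun t => Phi g e γ t ^ (1 / 4 : ℝ) with hp_def
  have hΦs := h.contDiffOn_Phi g he
  have hp : ContDiffOn ℝ ∞ p I := hΦs.rpow_const_of_ne fun t ht => (hpos t ht).ne'
  have hp_pos : ∀ t ∈ I, 0 < p t := fun t ht => Real.rpow_pos_of_pos (hpos t ht) _
  have hp_cont : ContinuousAt p t₀ := hp.continuousOn.continuousAt (h.isOpen.mem_nhds ht₀)
  have hf : ∀ t ∈ I, (p t)⁻¹ * deriv p t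
      = 1 / 4 * deriv (fun t => Real.log (Phi g e γ t)) t := fun t ht =>
    inv_rpow_mul_deriv_rpow _ (hΦs.differentiableAt_of_isOpen h.isOpen ht) (hpos t ht)
  have hf' : deriv (fun t => (p t)⁻¹ * deriv p t) t₀
      = 1 / 4 * deriv (deriv fun t => Real.log (Phi g e γ t)) t₀ := by
    have : (fun t => (p t)⁻¹ * deriv p t) =ᶠ[𝓝 t₀]
        fun t => 1 / 4 * deriv (fun t => Real.log (Phi g e γ t)) t := by
      filter_upwards [h.isOpen.mem_nhds ht₀] with t ht using hf t ht
    rw [this.deriv_eq, deriv_const_mul_field]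
  have hp_sq : (p t₀)⁻¹ ^ 2 = Phi g e γ t₀ ^ (-(1 / 2) : ℝ) := by
    rw [hp_def, ← Real.rpow_neg (hpos t₀ ht₀).le, ← Real.rpow_natCast,
      ← Real.rpow_mul (hpos t₀ ht₀).le]
    norm_num
  -- Independence of the choice: near `s t₀` any admissible `δ` equals `γ ∘ τ`, with `τ` the local
  -- inverse of `s`. The constants come from `f = (ln Φ)'/4`, as `2/4 = 1/2` and `(1/4)² = 1/16`.
  have hval : ∀ (s : ℝ → ℝ) (δ : ℝ → M), IsConformalArcLengthReparam g e γ t₀ s δ →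
      alpha g e δ (s t₀) = Phi g e γ t₀ ^ (-(1 / 2) : ℝ) *
        (alpha g e γ t₀ - 1 / 2 * deriv (deriv fun t => Real.log (Phi g e γ t)) t₀
          + 1 / 16 * deriv (fun t => Real.log (Phi g e γ t)) t₀ ^ 2) := by
    intro s δ hsδ
    obtain ⟨τ, hτ0, hτc, -, hτ⟩ :=
      exists_local_inverse hsδ.hasDerivAt hp_cont (hp_pos t₀ ht₀).ne'
    have htend : Tendsto τ (𝓝 (s t₀)) (𝓝 t₀) := by simpa only [ContinuousAt, hτ0] using hτc
    have hδ : ∀ᶠ r in 𝓝 (s t₀), δ r = γ (τ r) := by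
      filter_upwards [hτ, htend.eventually hsδ.reparam] with r hr hδr
      rw [← hδr, hr.1]
    rw [h.alpha_reparam g he hp hp_pos (hτ0.symm ▸ ht₀) (hτ.mono fun r hr => hr.2) hδ, hτ0, hp_sq,
      hf', hf t₀ ht₀]
    ring
  constructor
  · rintro ⟨s, δ, hsδ, rfl⟩
    rw [hval s δ hsδ]
    ring
  · intro hK
    -- Existence: a primitive of `p` serves as `s`, and `γ` composed with its local inverse as `δ`.
    obtain ⟨s, hs⟩ := exists_eventually_hasDerivAt h.isOpen hp.continuousOn ht₀
    obtain ⟨τ, -, -, hτ, -⟩ := exists_local_inverse hs hp_cont (hp_pos t₀ ht₀).ne'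
    have hsδ : IsConformalArcLengthReparam g e γ t₀ s (fun r => γ (τ r)) :=
      ⟨hs, hτ.mono fun t ht => congrArg γ ht⟩
    refine ⟨s, _, hsδ, ?_⟩
    rw [hval s _ hsδ, hK]
    ring

end

/-- With `(ln φ)'' = φ''/φ - (φ'/φ)²`, the coefficient of `(φ'/φ)²` becomes `1/2 + 1/16 = 9/16`; a
factor `φ⁻²` is then absorbed into the power. -/
theorem log_deriv_expression {φ : ℝ → ℝ} {I : Set ℝ} (hI : IsOpen I) (hφ : ContDiffOn ℝ ∞ φ I)
    (hpos : ∀ t ∈ I, 0 < φ t) {t : ℝ} (ht : t ∈ I) (α : ℝ) :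
    φ t ^ (-(1 / 2) : ℝ) * (α - 1 / 2 * deriv (deriv fun r => Real.log (φ r)) t
        + 1 / 16 * deriv (fun r => Real.log (φ r)) t ^ 2)
      = φ t ^ (-(5 / 2) : ℝ) * (φ t ^ 2 * α - 1 / 2 * φ t * deriv (deriv φ) t
        + 9 / 16 * deriv φ t ^ 2) := by
  have hne := (hpos t ht).ne'
  have h1 : ∀ r ∈ I, deriv (fun r => Real.log (φ r)) r = deriv φ r / φ r := fun r hr =>
    ((hφ.differentiableAt_of_isOpen hI hr).hasDerivAt.log (hpos r hr).ne').deriv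
  have h2 : deriv (deriv fun r => Real.log (φ r)) t
      = (deriv (deriv φ) t * φ t - deriv φ t * deriv φ t) / φ t ^ 2 := by
    have heq : deriv (fun r => Real.log (φ r)) =ᶠ[𝓝 t] fun r => deriv φ r / φ r := by
      filter_upwards [hI.mem_nhds ht] with r hr using h1 r hr
    rw [heq.deriv_eq]
    exact (((hφ.deriv_of_isOpen hI (m := ∞) (by simp)).differentiableAt_of_isOpen hI
      ht).hasDerivAt.div (hφ.differentiableAt_of_isOpen hI ht).hasDerivAt hne).deriv
  have h3 : φ t ^ (-(1 / 2) : ℝ) = φ t ^ (-(5 / 2) : ℝ) * φ t ^ 2 := by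
    rw [← Real.rpow_natCast, ← Real.rpow_add (hpos t ht)]
    norm_num
  rw [h1 t ht, h2, h3]
  field_simp
  ring

end ConformalCurve

theorem mainTheorem7 {n : ℕ} (hn : 3 ≤ n)
    {M : Type*} [TopologicalSpace M] [ChartedSpace (EuclideanSpace ℝ (Fin n)) M]
    [IsManifold (𝓡 n) ∞ M]
    (c : ConformalCurve.ConformalStructure n M)
    (J : Set ℝ) (hJ : IsOpen J) (γ : ℝ → M)
    (hγ : ContMDiffOn 𝓘(ℝ, ℝ) (𝓡 n) ∞ γ J)
    (hreg : ∀ t ∈ J, mfderiv 𝓘(ℝ, ℝ) (𝓡 n) γ t (1 : ℝ) ≠ 0)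
    (g : ConformalCurve.Metric n M) (hg : g ∈ c.metrics)
    (t₀ : ℝ) (ht₀ : t₀ ∈ J)
    (e : OpenPartialHomeomorph M (EuclideanSpace ℝ (Fin n)))
    (he : e ∈ IsManifold.maximalAtlas (𝓡 n) ∞ M) (het₀ : γ t₀ ∈ e.source)
    (hΦ : ConformalCurve.Phi g e γ t₀ ≠ 0) :
    ∃ K₁ : ℝ,
      (∀ K : ℝ, ConformalCurve.IsFirstConformalCurvatureAt g e γ t₀ K ↔ K = K₁) ∧
      K₁ = -(1 / 2) * ConformalCurve.Phi g e γ t₀ ^ (-(1 / 2) : ℝ) *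
        (ConformalCurve.alpha g e γ t₀
          - 1 / 2 * deriv (deriv fun t => Real.log (ConformalCurve.Phi g e γ t)) t₀
          + 1 / 16 * deriv (fun t => Real.log (ConformalCurve.Phi g e γ t)) t₀ ^ 2) ∧
      K₁ = -(1 / 2) * ConformalCurve.Phi g e γ t₀ ^ (-(5 / 2) : ℝ) *
        (ConformalCurve.Phi g e γ t₀ ^ 2 * ConformalCurve.alpha g e γ t₀
          - 1 / 2 * ConformalCurve.Phi g e γ t₀ * deriv (deriv (ConformalCurve.Phi g e γ)) t₀
          + 9 / 16 * deriv (ConformalCurve.Phi g e γ) t₀ ^ 2) := by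

  have h := ConformalCurve.isRegularInChart_of_contMDiffOn he hJ hγ hreg
  obtain ⟨I, htI, hI, hpos⟩ := h.exists_Phi_pos g he ⟨ht₀, het₀⟩ hΦ
  -- The witness is read off from the right side of the equivalence, so the logarithmic formula
  -- holds by `rfl`.
  refine ⟨_, hI.isFirstConformalCurvatureAt_iff g he hpos htI, rfl, ?_⟩
  rw [mul_assoc, mul_assoc, ConformalCurve.log_deriv_expression hI.isOpen (hI.contDiffOn_Phi g he)
    hpos htI]
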